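/- Let $X$ be a compact Polish space with Borel $\sigma$-field $\mathscr B$ and a Borel probability measure $m$, let $(T,\mathscr A,p)$ be a probability space, and let $f:T\times X\to X$ be a measurable map; write $f_t=f(t,\cdot)$. Let $(\Omega,\mathbb P)=(T^{\mathbb N},p^{\mathbb N})$ and, for $\omega=(\omega_1,\omega_2,\dots)\in\Omega$, put $f^0_\omega=\mathrm{id}$ and $f^n_\omega=f_{\omega_n}\circ\cdots\circ f_{\omega_1}$ for $n\ge 1$. Let $P^n(x,A)=\mathbb P(\{\omega: f^n_\omega(x)\in A\})$ for $x\in X$, $A\in\mathscr B$. Assume that for some integer $n_0\ge 1$ and some continuous map $x\mapsto p(x,\cdot)$ from $X$ to $L^1(m)$, $$P^{n_0}(x,A)=\int_A p(x,y)\,dm(y)\qquad\text{for all } x\in X,\ A\in\mathscr B.$$ Then there are finitely many Borel probability measures $\mu_1,\dots,\mu_r$ on $X$ such that: (0) each $\mu_i$ is stationary, i.e. $\mu_i(A)=\int \mu_i(f_t^{-1}A)\,dp(t)$ for all $A\in\mathscr B$, and ergodic, i.e. $\mathbb P\times\mu_i$ is an ergodic invariant measure of the skew product $(\omega,x)\mapsto(\sigma\omega,f_{\omega_1}(x))$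 on $\Omega\times X$, where $\sigma$ is the left shift; (1) each $\mu_i$ is absolutely continuous with respect to $m$; (2) the supports $\{d\mu_i/dm\neq 0\}$ are pairwise disjoint up to $m$-null sets; (3) for $\mathbb P$-almost every $\omega\in\Omega$, $m\bigl(X\setminus(B_\omega(\mu_1)\cup\dots\cup B_\omega(\mu_r))\bigr)=0$, where $$B_\omega(\mu_i)=\Bigl\{x\in X:\ \lim_{n\to\infty}\frac1n\sum_{j=0}^{n-1}\delta_{f^j_\omega(x)}=\mu_i\ \text{ in the weak* topology}\Bigr\}.$$ -/

import Mathlib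

open MeasureTheory Filter Topology
open scoped NNReal ENNReal

namespace RandomMap

variable {T X : Type*} [MeasurableSpace T] [MeasurableSpace X]

/-- The Bernoulli measure `ℙ = p^ℕ` on the noise space `Ω = T^ℕ`. The noise sequence
`(ω₁, ω₂, …)` is indexed from `0`, so that `ω n` stands for the noise at step `n + 1`. -/
noncomputable def noiseMeasure (p : Measure T) [IsProbabilityMeasure p] : Measure (ℕ → T) :=
  Measure.infinitePi (fun _ : ℕ => p)

/-- The random iterates `f_ω^0 = id` and `f_ω^{n+1} = f_{ω_{n+1}} ∘ f_ω^n`. -/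
def iter (f : T → X → X) (ω : ℕ → T) : ℕ → X → X
  | 0 => id
  | n + 1 => f (ω n) ∘ iter f ω n

/-- The `n`-th transition probability `P^n(x, A) = ℙ {ω | f_ω^n(x) ∈ A}`. -/
noncomputable def transitionProb (p : Measure T) [IsProbabilityMeasure p] (f : T → X → X)
    (n : ℕ) (x : X) (A : Set X) : ℝ≥0∞ :=
  noiseMeasure p {ω | iter f ω n x ∈ A}

/-- `μ` is a stationary measure of `f`: `μ(A) = ∫ (f_t)_* μ(A) dp(t)` for all measurable `A`. -/
def IsStationary (p : Measure T) (f : T → X → X) (μ : Measure X) : Prop :=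
  ∀ A : Set X, MeasurableSet A → μ A = ∫⁻ t, (μ.map (f t)) A ∂p

/-- The skew product `F(ω, x) = (σ ω, f_{ω₁}(x))`, with `σ` the left shift. -/
def skewProduct (f : T → X → X) (z : (ℕ → T) × X) : (ℕ → T) × X :=
  (fun n => z.1 (n + 1), f (z.1 0) z.2)

/-- `μ` is ergodic for `f`: `ℙ × μ` is an ergodic invariant measure of the skew product. -/
def IsErgodic (p : Measure T) [IsProbabilityMeasure p] (f : T → X → X) (μ : Measure X) : Prop :=
  Ergodic (skewProduct f) ((noiseMeasure p).prod μ)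

/-- The support, up to an `m`-null set, of a measure `μ` that is absolutely continuous with
respect to `m`: the set where the density `dμ/dm` does not vanish. -/
noncomputable def densitySupport (m μ : Measure X) : Set X :=
  Function.support (μ.rnDeriv m)

/-- The empirical measure `(1/n) ∑_{j < n} δ_{f_ω^j(x)}`. -/
noncomputable def empiricalMeasure (f : T → X → X) (ω : ℕ → T) (x : X) (n : ℕ) :
    FiniteMeasure X :=
  (n : ℝ≥0)⁻¹ • ∑ j ∈ Finset.range n, (diracProba (iter f ω j x)).toFiniteMeasure

/-- The fiberwise statistical basin of attraction `B_ω(μ)`: the points `x` whose empirical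
measures along `ω` converge to `μ` in the weak* topology. -/
def basin [TopologicalSpace X] [OpensMeasurableSpace X] (f : T → X → X) (ω : ℕ → T)
    (μ : ProbabilityMeasure X) : Set X :=
  {x | Tendsto (empiricalMeasure f ω x) atTop (𝓝 μ.toFiniteMeasure)}

/-- Finitude of physical measures. -/
def FPM [TopologicalSpace X] [OpensMeasurableSpace X] (m : Measure X)
    (p : Measure T) [IsProbabilityMeasure p] (f : T → X → X) : Prop :=
  ∃ (r : ℕ) (μ : Fin r → ProbabilityMeasure X),
    (∀ i, IsStationary p f (μ i : Measure X) ∧ IsErgodic p f (μ i : Measure X)) ∧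
    (∀ i, (μ i : Measure X) ≪ m) ∧
    (∀ i j, i ≠ j →
      m (densitySupport m (μ i : Measure X) ∩ densitySupport m (μ j : Measure X)) = 0) ∧
    ∀ᵐ ω ∂(noiseMeasure p), m (⋃ i, basin f ω (μ i))ᶜ = 0

end RandomMap

/-!
Write `Q` for the `n₀`-step transition operator. Since the densities `ρ x` depend continuously on
`x` in `L¹(m)`, `Q` maps bounded measurable functions to continuous ones
(`strongFeller_of_density`), so every bounded harmonic function is continuous
(`IsHarmonic.continuous`). The densities at points of disjoint absorbing sets have `L¹`-distance at
least `1`, so compactness of `ρ(X)` bounds the number of pairwise disjoint absorbing sets, and there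
is a family `K₁, …, K_r` of the largest size (`exists_maximal_absorbingFamily`). The sets where a
harmonic function attains its extrema are absorbing, so by maximality a harmonic function is constant
on each `K_i` and attains its minimum on `⋃ K_i` (`IsAbsorbingFamily.harmonic_eq`,
`IsAbsorbingFamily.le_harmonic`).

Each `K_i` carries a stationary probability measure `μ_i`: the image under `Q` of a weak* limit of
averaged laws of an orbit (`IsAbsorbing.exists_stationary`). It has a density because `μ_i Q = μ_i`,
and the density supports are disjoint because the `K_i` are.

The link between the skew product and the transition operator is that the fiber probability
`x ↦ ℙ {ω | (ω, x) ∈ B}` of an invariant set `B` is harmonic (`isHarmonic_fiberProb`). It is therefore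
constant on `K_i`, which makes the fibers of `B` over `K_i` independent of all boxes and hence of
themselves; this zero-one law gives ergodicity (`IsAbsorbing.isErgodic`). Finally let `G` be the set of
pairs `(ω, x)` whose time averages converge to one of the `μ_i`. It is invariant, and by Birkhoff's
pointwise ergodic theorem (`ae_tendsto_birkhoffAverage`) its fiber probability is `1` at some, hence
every, point of each `K_i`. As the minimum is attained there, the fiber probability is `1` at every
`x ∈ X`, and Fubini's theorem exchanges the quantifiers over `x` and `ω`.
-/

namespace RandomMap

/-! ### The noise and the averaged transition -/

section Noise

lemma skewProduct_iterate_snd {T X : Type*} (f : T → X → X) (z : (ℕ → T) × X) (n : ℕ) :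
    ((skewProduct f)^[n] z).2 = iter f z.1 n z.2 := by
  have key : ∀ n, (skewProduct f)^[n] z = (fun k => z.1 (k + n), iter f z.1 n z.2) := by
    intro n
    induction n with
    | zero => rfl
    | succ n ih =>
      rw [Function.iterate_succ_apply', ih]
      simp [skewProduct, iter, Nat.add_assoc, Nat.add_comm 1 n]
  rw [key]

variable {T X : Type*} [MeasurableSpace T] [MeasurableSpace X]

/-- The noise sequence `(t, ω₁, ω₂, …)`. -/
def consNoise (z : T × (ℕ → T)) : ℕ → T
  | 0 => z.1
  | n + 1 => z.2 n

lemma measurable_consNoise : Measurable (consNoise (T := T)) := by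
  refine measurable_pi_lambda _ fun n => ?_
  cases n with
  | zero => exact measurable_fst
  | succ n => exact (measurable_pi_apply n).comp measurable_snd

instance (p : Measure T) [IsProbabilityMeasure p] : IsProbabilityMeasure (noiseMeasure p) := by
  unfold noiseMeasure; infer_instance

lemma measurableSet_box {t : ℕ → Set T} (ht : ∀ i, MeasurableSet (t i)) (n : ℕ) :
    MeasurableSet {ω : ℕ → T | ∀ i < n, ω i ∈ t i} := by
  simp only [Set.ofPred_forall]
  exact MeasurableSet.iInter fun i => MeasurableSet.iInter fun _ => measurable_pi_apply i (ht i)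

lemma noiseMeasure_box (p : Measure T) [IsProbabilityMeasure p] {t : ℕ → Set T}
    (ht : ∀ i, MeasurableSet (t i)) (n : ℕ) :
    noiseMeasure p {ω | ∀ i < n, ω i ∈ t i} = ∏ i ∈ Finset.range n, p (t i) := by
  have h := Measure.infinitePi_pi (fun _ : ℕ => p) (s := Finset.range n) (t := t)
    (fun i _ => ht i)
  rw [← h, noiseMeasure]
  congr 1
  ext ω
  simp

/-- A measure with the right mass on the boxes that constrain the first `n` coordinates is the
Bernoulli measure. -/
lemma eq_noiseMeasure_of_box (p : Measure T) [IsProbabilityMeasure p] {ν : Measure (ℕ → T)}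
    (h : ∀ (t : ℕ → Set T), (∀ i, MeasurableSet (t i)) → ∀ n,
      ν {ω | ∀ i < n, ω i ∈ t i} = ∏ i ∈ Finset.range n, p (t i)) :
    ν = noiseMeasure p := by
  classical
  refine Measure.eq_infinitePi _ fun s t ht => ?_
  have hlt : ∀ i ∈ s, i < s.sup id + 1 := fun i hi =>
    Nat.lt_succ_of_le (Finset.le_sup (f := id) hi)
  have h' := h (fun i => if i ∈ s then t i else Set.univ)
    (fun i => by split_ifs; exacts [ht i, MeasurableSet.univ]) (s.sup id + 1)
  have hset : {ω : ℕ → T | ∀ i < s.sup id + 1, ω i ∈ if i ∈ s then t i else Set.univ}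
      = Set.pi s t := by
    ext ω
    simp only [Set.mem_ofPred_eq, Set.mem_pi, Finset.mem_coe]
    constructor
    · intro H i hi
      simpa [hi] using H i (hlt i hi)
    · intro H i _
      split_ifs with hi
      exacts [H i hi, Set.mem_univ _]
  rw [hset] at h'
  rw [h']
  symm
  refine Finset.prod_subset_one_on_sdiff (fun i hi => Finset.mem_range.2 (hlt i hi)) ?_ ?_
  · intro i hi
    simp [(Finset.mem_sdiff.1 hi).2]
  · intro i hi
    simp [hi]

lemma measurePreserving_consNoise (p : Measure T) [IsProbabilityMeasure p] :
    MeasurePreserving consNoise (p.prod (noiseMeasure p)) (noiseMeasure p) := by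
  refine ⟨measurable_consNoise, eq_noiseMeasure_of_box p fun t ht n => ?_⟩
  rw [Measure.map_apply measurable_consNoise (measurableSet_box ht n)]
  cases n with
  | zero => simp
  | succ n =>
    have : consNoise ⁻¹' {ω : ℕ → T | ∀ i < n + 1, ω i ∈ t i}
        = t 0 ×ˢ {ω : ℕ → T | ∀ i < n, ω i ∈ t (i + 1)} := by
      ext z
      simp only [Set.mem_preimage, Set.mem_ofPred_eq, Set.mem_prod]
      constructor
      · exact fun H => ⟨H 0 n.succ_pos, fun i hi => H (i + 1) (Nat.succ_lt_succ hi)⟩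
      · rintro ⟨h0, H⟩ i hi
        cases i with
        | zero => exact h0
        | succ i => exact H i (Nat.lt_of_succ_lt_succ hi)
    rw [this, Measure.prod_prod, noiseMeasure_box p (fun i => ht (i + 1)), Finset.prod_range_succ',
      mul_comm]

/-- The action of the averaged transition on measures: the law of `f t x` for independent
`t ∼ p` and `x ∼ μ`. -/
noncomputable def push (p : Measure T) (f : T → X → X) (μ : Measure X) : Measure X :=
  (p.prod μ).map (Function.uncurry f)

lemma isStationary_of_push_eq (p : Measure T) {f : T → X → X} (hf : Measurable (Function.uncurry f))
    {μ : Measure X} [SFinite μ] (h : push p f μ = μ) : IsStationary p f μ := by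
  intro A hA
  conv_lhs => rw [← h, push, Measure.map_apply hf hA, Measure.prod_apply (hf hA)]
  refine lintegral_congr fun t => ?_
  have ht : Measurable (f t) := hf.comp measurable_prodMk_left
  rw [Measure.map_apply ht hA]
  rfl

variable (p : Measure T) [IsProbabilityMeasure p] {f : T → X → X}

lemma isProbabilityMeasure_push (hf : Measurable (Function.uncurry f)) (μ : Measure X)
    [IsProbabilityMeasure μ] : IsProbabilityMeasure (push p f μ) :=
  Measure.isProbabilityMeasure_map hf.aemeasurable

lemma isProbabilityMeasure_push_iterate (hf : Measurable (Function.uncurry f)) (μ : Measure X)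
    [IsProbabilityMeasure μ] (n : ℕ) : IsProbabilityMeasure ((push p f)^[n] μ) := by
  induction n with
  | zero => simpa
  | succ n ih => rw [Function.iterate_succ_apply']; exact isProbabilityMeasure_push p hf _

lemma measurable_skewProduct (hf : Measurable (Function.uncurry f)) :
    Measurable (skewProduct f) := by
  refine Measurable.prodMk (measurable_pi_lambda _ fun n =>
    (measurable_pi_apply (n + 1)).comp measurable_fst) ?_
  have h0 : Measurable fun z : (ℕ → T) × X => (z.1 0, z.2) :=
    ((measurable_pi_apply 0).comp measurable_fst).prodMk measurable_snd
  exact hf.comp h0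

/-- One step of the skew product consumes one noise variable: it leaves the rest of the noise
Bernoulli and independent of the new point, which has law `push p f μ`. -/
lemma measurePreserving_skewProduct_push (hf : Measurable (Function.uncurry f)) (μ : Measure X)
    [IsProbabilityMeasure μ] :
    MeasurePreserving (skewProduct f) ((noiseMeasure p).prod μ)
      ((noiseMeasure p).prod (push p f μ)) := by
  have := isProbabilityMeasure_push p hf μ
  have h1 : MeasurePreserving (Prod.map consNoise id)
      ((p.prod (noiseMeasure p)).prod μ) ((noiseMeasure p).prod μ) :=
    (measurePreserving_consNoise p).prod (MeasurePreserving.id μ)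
  have h2 : MeasurePreserving (Prod.map Prod.swap id)
      ((p.prod (noiseMeasure p)).prod μ) (((noiseMeasure p).prod p).prod μ) :=
    Measure.measurePreserving_swap.prod (MeasurePreserving.id μ)
  have h3 := measurePreserving_prodAssoc (noiseMeasure p) p μ
  have h4 : MeasurePreserving (Prod.map id (Function.uncurry f))
      ((noiseMeasure p).prod (p.prod μ)) ((noiseMeasure p).prod (push p f μ)) :=
    (MeasurePreserving.id (noiseMeasure p)).prod ⟨hf, rfl⟩
  have h5 := h4.comp (h3.comp h2)
  refine ⟨measurable_skewProduct hf, ?_⟩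
  rw [← h1.map_eq, Measure.map_map (measurable_skewProduct hf) h1.measurable, ← h5.map_eq]
  rfl

lemma measurable_iter (hf : Measurable (Function.uncurry f)) (n : ℕ) :
    Measurable fun z : (ℕ → T) × X => iter f z.1 n z.2 := by
  simp only [← skewProduct_iterate_snd]
  exact measurable_snd.comp ((measurable_skewProduct hf).iterate n)

lemma map_iter_prod (hf : Measurable (Function.uncurry f)) (μ : Measure X)
    [IsProbabilityMeasure μ] (n : ℕ) :
    ((noiseMeasure p).prod μ).map (fun z => iter f z.1 n z.2) = (push p f)^[n] μ := by
  induction n generalizing μ with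
  | zero => exact Measure.snd_prod
  | succ n ih =>
    have := isProbabilityMeasure_push p hf μ
    rw [Function.iterate_succ_apply, ← ih (push p f μ),
      ← (measurePreserving_skewProduct_push p hf μ).map_eq,
      Measure.map_map (measurable_iter hf n) (measurable_skewProduct hf)]
    congr 1
    ext z
    simp only [Function.comp_apply, ← skewProduct_iterate_snd, Function.iterate_succ_apply]

/-- The law of `f_ω^n(x)`, that is the transition probability `P^n(x, ·)` as a measure. -/
noncomputable def law (p : Measure T) [IsProbabilityMeasure p] (f : T → X → X) (n : ℕ) (x : X) :
    Measure X :=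
  (noiseMeasure p).map fun ω => iter f ω n x

lemma isProbabilityMeasure_law (hf : Measurable (Function.uncurry f)) (n : ℕ) (x : X) :
    IsProbabilityMeasure (law p f n x) :=
  Measure.isProbabilityMeasure_map
    ((measurable_iter hf n).comp measurable_prodMk_right).aemeasurable

lemma law_eq_push_iterate (hf : Measurable (Function.uncurry f)) (n : ℕ) (x : X) :
    law p f n x = (push p f)^[n] (Measure.dirac x) := by
  rw [← map_iter_prod p hf, Measure.prod_dirac,
    Measure.map_map (measurable_iter hf n) measurable_prodMk_right]
  rfl

lemma law_apply (hf : Measurable (Function.uncurry f)) (n : ℕ) (x : X) {A : Set X}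
    (hA : MeasurableSet A) : law p f n x A = transitionProb p f n x A :=
  Measure.map_apply ((measurable_iter hf n).comp measurable_prodMk_right) hA

lemma push_apply (hf : Measurable (Function.uncurry f)) (μ : Measure X) [SFinite μ]
    {A : Set X} (hA : MeasurableSet A) : push p f μ A = ∫⁻ x, p {t | f t x ∈ A} ∂μ := by
  rw [push, Measure.map_apply hf hA, Measure.prod_apply_symm (hf hA)]
  rfl

lemma integrable_of_bounded {Y : Type*} [MeasurableSpace Y] {μ : Measure Y} [IsFiniteMeasure μ]
    {φ : Y → ℝ} (hφ : Measurable φ) {C : ℝ} (hC : ∀ y, |φ y| ≤ C) : Integrable φ μ :=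
  Integrable.of_bound hφ.aestronglyMeasurable C (ae_of_all _ hC)

lemma integral_push (hf : Measurable (Function.uncurry f)) (μ : Measure X)
    [IsProbabilityMeasure μ] {φ : X → ℝ} (hφ : Measurable φ) {C : ℝ} (hC : ∀ x, |φ x| ≤ C) :
    ∫ y, φ y ∂(push p f μ) = ∫ x, ∫ t, φ (f t x) ∂p ∂μ := by
  rw [push, integral_map hf.aemeasurable hφ.aestronglyMeasurable,
    integral_prod_symm (fun z => φ (Function.uncurry f z))
      (integrable_of_bounded (hφ.comp hf) fun z => hC _)]
  rfl

lemma integral_push_iterate (hf : Measurable (Function.uncurry f)) (μ : Measure X)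
    [IsProbabilityMeasure μ] (n : ℕ) {φ : X → ℝ} (hφ : Measurable φ) {C : ℝ}
    (hC : ∀ x, |φ x| ≤ C) :
    ∫ y, φ y ∂((push p f)^[n] μ) = ∫ x, ∫ y, φ y ∂(law p f n x) ∂μ := by
  have hm := measurable_iter hf n
  rw [← map_iter_prod p hf, integral_map hm.aemeasurable hφ.aestronglyMeasurable,
    integral_prod_symm (fun z : (ℕ → T) × X => φ (iter f z.1 n z.2))
      (integrable_of_bounded (hφ.comp hm) fun z => hC _)]
  refine integral_congr_ae (ae_of_all _ fun x => ?_)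
  dsimp only
  have hx : Measurable fun ω => iter f ω n x := hm.comp measurable_prodMk_right
  rw [law, integral_map hx.aemeasurable hφ.aestronglyMeasurable]

end Noise

/-! ### Harmonic functions and the strong Feller property -/

section Harmonic

variable {T X : Type*} [MeasurableSpace T] [MeasurableSpace X]

/-- A bounded measurable function `h` with `h x = ∫ h (f t x) dp(t)`. -/
structure IsHarmonic (p : Measure T) (f : T → X → X) (h : X → ℝ) : Prop where
  measurable : Measurable h
  bounded : ∃ C, ∀ x, |h x| ≤ C
  integral_eq : ∀ x, ∫ t, h (f t x) ∂p = h x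

lemma IsHarmonic.neg {p : Measure T} {f : T → X → X} {h : X → ℝ} (hh : IsHarmonic p f h) :
    IsHarmonic p f (fun x => -h x) where
  measurable := hh.measurable.neg
  bounded := by simpa using hh.bounded
  integral_eq x := by rw [integral_neg, hh.integral_eq]

/-- The strong Feller property of the `n`-step transition: it maps bounded measurable functions
to continuous ones. -/
def StrongFeller [TopologicalSpace X] (p : Measure T) [IsProbabilityMeasure p] (f : T → X → X)
    (n : ℕ) : Prop :=
  ∀ φ : X → ℝ, Measurable φ → (∃ C, ∀ x, |φ x| ≤ C) →
    Continuous fun x => ∫ y, φ y ∂(law p f n x)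

variable (p : Measure T) [IsProbabilityMeasure p] {f : T → X → X}

lemma IsHarmonic.integral_law (hf : Measurable (Function.uncurry f)) {h : X → ℝ}
    (hh : IsHarmonic p f h) (n : ℕ) (x : X) : ∫ y, h y ∂(law p f n x) = h x := by
  obtain ⟨C, hC⟩ := hh.bounded
  rw [law_eq_push_iterate p hf]
  induction n with
  | zero => exact integral_dirac' _ _ hh.measurable.stronglyMeasurable
  | succ n ih =>
    have := isProbabilityMeasure_push_iterate p hf (Measure.dirac x) n
    rw [Function.iterate_succ_apply', integral_push p hf _ hh.measurable hC]
    simpa only [hh.integral_eq] using ih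

lemma IsHarmonic.continuous [TopologicalSpace X] (hf : Measurable (Function.uncurry f)) {n : ℕ}
    (hF : StrongFeller p f n) {h : X → ℝ} (hh : IsHarmonic p f h) : Continuous h := by
  simpa only [hh.integral_law p hf] using hF h hh.measurable hh.bounded

variable {p} {m : Measure X} {n : ℕ} {ρ : X → (X →₁[m] ℝ)}

lemma density_nonneg (hP : ∀ (x : X) (A : Set X), MeasurableSet A →
      (transitionProb p f n x A).toReal = ∫ y in A, ρ x y ∂m) (x : X) :
    0 ≤ᵐ[m] ρ x :=
  ae_nonneg_of_forall_setIntegral_nonneg (L1.integrable_coeFn (ρ x)) fun A hA _ => by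
    rw [← hP x A hA]; exact ENNReal.toReal_nonneg

lemma law_eq_withDensity (hf : Measurable (Function.uncurry f))
    (hP : ∀ (x : X) (A : Set X), MeasurableSet A →
      (transitionProb p f n x A).toReal = ∫ y in A, ρ x y ∂m) (x : X) :
    law p f n x = m.withDensity fun y => ENNReal.ofReal (ρ x y) := by
  have := isProbabilityMeasure_law p hf n x
  ext A hA
  rw [withDensity_apply _ hA, ← ofReal_integral_eq_lintegral_ofReal
    (L1.integrable_coeFn (ρ x)).integrableOn (ae_restrict_of_ae (density_nonneg hP x)),
    ← hP x A hA, ← law_apply p hf n x hA, ENNReal.ofReal_toReal (measure_ne_top _ _)]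

lemma integral_law_eq (hf : Measurable (Function.uncurry f))
    (hP : ∀ (x : X) (A : Set X), MeasurableSet A →
      (transitionProb p f n x A).toReal = ∫ y in A, ρ x y ∂m) (x : X) (φ : X → ℝ) :
    ∫ y, φ y ∂(law p f n x) = ∫ y, ρ x y * φ y ∂m := by
  rw [law_eq_withDensity hf hP, integral_withDensity_eq_integral_toReal_smul₀
    (L1.integrable_coeFn (ρ x)).aestronglyMeasurable.aemeasurable.ennreal_ofReal
    (ae_of_all _ fun _ => ENNReal.ofReal_lt_top)]
  refine integral_congr_ae ?_
  filter_upwards [density_nonneg hP x] with y hy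
  simp only [smul_eq_mul]
  rw [ENNReal.toReal_ofReal hy]

/-- An `L¹`-continuous density makes the transition strong Feller, because pairing with a bounded
function is Lipschitz in the density. -/
lemma strongFeller_of_density [TopologicalSpace X] (hf : Measurable (Function.uncurry f))
    (hρ : Continuous ρ) (hP : ∀ (x : X) (A : Set X), MeasurableSet A →
      (transitionProb p f n x A).toReal = ∫ y in A, ρ x y ∂m) : StrongFeller p f n := by
  rintro φ hφ ⟨C, hC⟩
  simp only [integral_law_eq hf hP]
  have hint : ∀ g : X →₁[m] ℝ, Integrable (fun y => g y * φ y) m := fun g =>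
    (L1.integrable_coeFn g).mul_bdd (c := C) hφ.aestronglyMeasurable (ae_of_all _ hC)
  have hLip : ∀ g g' : X →₁[m] ℝ,
      |(∫ y, g y * φ y ∂m) - ∫ y, g' y * φ y ∂m| ≤ C * dist g g' := by
    intro g g'
    rw [← integral_sub (hint g) (hint g'), dist_eq_norm, L1.norm_eq_integral_norm,
      ← integral_const_mul, ← Real.norm_eq_abs]
    refine norm_integral_le_of_norm_le ((L1.integrable_coeFn _).norm.const_mul C) ?_
    filter_upwards [Lp.coeFn_sub g g'] with y hy
    rw [hy, Pi.sub_apply, ← sub_mul, norm_mul, mul_comm]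
    exact mul_le_mul_of_nonneg_right (hC y) (norm_nonneg _)
  have hcont : Continuous fun g : X →₁[m] ℝ => ∫ y, g y * φ y ∂m := by
    refine (LipschitzWith.of_dist_le_mul (K := C.toNNReal) fun g g' => ?_).continuous
    refine (hLip g g').trans ?_
    gcongr
    exact Real.le_coe_toNNReal C
  exact hcont.comp hρ

end Harmonic

/-! ### Absorbing sets -/

section Absorbing

variable {T X : Type*} [MeasurableSpace T] [TopologicalSpace X]

/-- A nonempty closed set that the random orbits almost surely never leave. -/
structure IsAbsorbing (p : Measure T) (f : T → X → X) (K : Set X) : Prop where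
  isClosed : IsClosed K
  nonempty : K.Nonempty
  ae_mem : ∀ x ∈ K, ∀ᵐ t ∂p, f t x ∈ K

/-- A finite family of pairwise disjoint absorbing sets. -/
structure IsAbsorbingFamily (p : Measure T) (f : T → X → X) {r : ℕ} (K : Fin r → Set X) :
    Prop where
  isAbsorbing : ∀ i, IsAbsorbing p f (K i)
  disjoint : Pairwise fun i j => Disjoint (K i) (K j)

variable {p : Measure T} {f : T → X → X} {K L : Set X} {r : ℕ} {F : Fin r → Set X}

/-- An absorbing set meets some member of a family of the largest size. -/
lemma IsAbsorbingFamily.exists_not_disjoint (hF : IsAbsorbingFamily p f F)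
    (hmax : ∀ K' : Fin (r + 1) → Set X, ¬ IsAbsorbingFamily p f K') (hL : IsAbsorbing p f L) :
    ∃ i, ¬ Disjoint L (F i) := by
  by_contra! H
  refine hmax (Fin.cons L F) ⟨Fin.cases hL hF.isAbsorbing, ?_⟩
  intro i j
  refine Fin.cases ?_ (fun i => ?_) i <;> refine Fin.cases ?_ (fun j => ?_) j
  · exact fun h => (h rfl).elim
  · exact fun _ => H j
  · exact fun _ => (H i).symm
  · exact fun h => hF.disjoint fun e => h (congrArg Fin.succ e)

/-- A member of a family of the largest size cannot be split. -/
lemma IsAbsorbingFamily.not_disjoint_of_subset (hF : IsAbsorbingFamily p f F)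
    (hmax : ∀ K' : Fin (r + 1) → Set X, ¬ IsAbsorbingFamily p f K') {i : Fin r}
    (hK : IsAbsorbing p f K) (hL : IsAbsorbing p f L) (hKF : K ⊆ F i) (hLF : L ⊆ F i) :
    ¬ Disjoint K L := by
  intro hKL
  have hsub : ∀ j, Function.update F i K j ⊆ F j := by
    intro j
    by_cases hj : j = i
    · subst hj; simpa using hKF
    · simp [Function.update_of_ne hj]
  have hF' : IsAbsorbingFamily p f (Function.update F i K) := by
    refine ⟨fun j => ?_, fun j k hjk => (hF.disjoint hjk).mono (hsub j) (hsub k)⟩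
    by_cases hj : j = i
    · subst hj; simpa using hK
    · simpa [Function.update_of_ne hj] using hF.isAbsorbing j
  obtain ⟨j, hj⟩ := hF'.exists_not_disjoint hmax hL
  by_cases hji : j = i
  · subst hji
    exact hj (by simpa using hKL.symm)
  · exact hj ((hF.disjoint (Ne.symm hji)).mono hLF (hsub j))

variable [MeasurableSpace X] [IsProbabilityMeasure p]

lemma IsAbsorbing.push_iterate_compl [BorelSpace X] (hK : IsAbsorbing p f K)
    (hf : Measurable (Function.uncurry f)) {μ : Measure X} [IsProbabilityMeasure μ]
    (hμ : μ Kᶜ = 0) (n : ℕ) : (push p f)^[n] μ Kᶜ = 0 := by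
  induction n with
  | zero => exact hμ
  | succ n ih =>
    have := isProbabilityMeasure_push_iterate p hf μ n
    rw [Function.iterate_succ_apply', push_apply p hf _ hK.isClosed.measurableSet.compl]
    refine lintegral_eq_zero_of_ae_eq_zero ?_
    have hmem : ∀ᵐ x ∂((push p f)^[n] μ), x ∈ K := ih
    filter_upwards [hmem] with x hx
    exact hK.ae_mem x hx

lemma IsAbsorbing.law_compl [BorelSpace X] (hK : IsAbsorbing p f K)
    (hf : Measurable (Function.uncurry f)) {x : X} (hx : x ∈ K) (n : ℕ) :
    law p f n x Kᶜ = 0 := by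
  rw [law_eq_push_iterate p hf]
  exact hK.push_iterate_compl hf
    (by simp [Measure.dirac_apply' x hK.isClosed.measurableSet.compl, hx]) n

/-- The densities of the transitions from two disjoint absorbing sets have disjoint supports, so
they are far apart in `L¹`. -/
lemma IsAbsorbing.one_le_dist_density [BorelSpace X] {m : Measure X} {n : ℕ}
    {ρ : X → (X →₁[m] ℝ)} (hf : Measurable (Function.uncurry f))
    (hP : ∀ (x : X) (A : Set X), MeasurableSet A →
      (transitionProb p f n x A).toReal = ∫ y in A, ρ x y ∂m)
    (hK : IsAbsorbing p f K) (hL : IsAbsorbing p f L) (hKL : Disjoint K L) {x y : X}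
    (hx : x ∈ K) (hy : y ∈ L) : 1 ≤ dist (ρ x) (ρ y) := by
  have := isProbabilityMeasure_law p hf n x
  have hKm := hK.isClosed.measurableSet
  have h1 : ∫ z in K, ρ x z ∂m = 1 := by
    rw [← hP x K hKm, ← law_apply p hf n x hKm, (prob_compl_eq_zero_iff hKm).1
      (hK.law_compl hf hx n), ENNReal.toReal_one]
  have h2 : ∫ z in K, ρ y z ∂m = 0 := by
    rw [← hP y K hKm, ← law_apply p hf n y hKm,
      measure_mono_null hKL.subset_compl_right (hL.law_compl hf hy n), ENNReal.toReal_zero]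
  have hix := L1.integrable_coeFn (ρ x)
  have hiy := L1.integrable_coeFn (ρ y)
  calc (1 : ℝ) = ∫ z in K, (ρ x z - ρ y z) ∂m := by
        rw [integral_sub hix.integrableOn hiy.integrableOn, h1, h2, sub_zero]
    _ ≤ ∫ z in K, ‖ρ x z - ρ y z‖ ∂m :=
        integral_mono (hix.sub hiy).integrableOn (hix.sub hiy).norm.integrableOn
          fun z => Real.le_norm_self _
    _ ≤ ∫ z, ‖ρ x z - ρ y z‖ ∂m :=
        setIntegral_le_integral (hix.sub hiy).norm (ae_of_all _ fun z => norm_nonneg _)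
    _ = dist (ρ x) (ρ y) := by
        rw [dist_eq_norm, L1.norm_eq_integral_norm]
        refine integral_congr_ae ?_
        filter_upwards [Lp.coeFn_sub (ρ x) (ρ y)] with z hz
        rw [hz, Pi.sub_apply]

/-- Since the densities form a compact subset of `L¹`, the size of a family of pairwise disjoint
absorbing sets is bounded, so there is a family of the largest size. -/
lemma exists_maximal_absorbingFamily [BorelSpace X] [CompactSpace X] {m : Measure X} {n : ℕ}
    {ρ : X → (X →₁[m] ℝ)} (hf : Measurable (Function.uncurry f)) (hρ : Continuous ρ)
    (hP : ∀ (x : X) (A : Set X), MeasurableSet A →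
      (transitionProb p f n x A).toReal = ∫ y in A, ρ x y ∂m) :
    ∃ (r : ℕ) (K : Fin r → Set X), IsAbsorbingFamily p f K ∧
      ∀ K' : Fin (r + 1) → Set X, ¬ IsAbsorbingFamily p f K' := by
  by_contra! H
  have hall : ∀ r, ∃ K : Fin r → Set X, IsAbsorbingFamily p f K := by
    intro r
    induction r with
    | zero => exact ⟨fun _ => ∅, ⟨fun i => i.elim0, fun i => i.elim0⟩⟩
    | succ r ih => obtain ⟨K, hK⟩ := ih; exact H r K hK
  obtain ⟨s, hsf, hcov⟩ := Metric.totallyBounded_iff.1 (isCompact_range hρ).totallyBounded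
    (1 / 2) (by norm_num)
  obtain ⟨K, hK⟩ := hall (hsf.toFinset.card + 1)
  choose x hx using fun i => (hK.isAbsorbing i).nonempty
  have hc : ∀ i, ∃ c ∈ hsf.toFinset, dist (ρ (x i)) c < 1 / 2 := by
    intro i
    simpa using hcov (Set.mem_range_self (x i))
  choose c hcs hcd using hc
  obtain ⟨i, -, j, -, hij, hcij⟩ := Finset.exists_ne_map_eq_of_card_lt_of_maps_to
    (s := Finset.univ) (t := hsf.toFinset) (f := c) (by simp) (fun i _ => hcs i)
  have h1 := (hK.isAbsorbing i).one_le_dist_density hf hP (hK.isAbsorbing j) (hK.disjoint hij)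
    (hx i) (hx j)
  have h2 := dist_triangle_right (ρ (x i)) (ρ (x j)) (c i)
  have h3 := hcd i
  have h4 := hcd j
  rw [← hcij] at h4
  linarith

/-- Where a harmonic function attains its maximum, it equals its average over the next step, so
the next step attains the maximum as well. -/
lemma IsAbsorbing.argmax (hK : IsAbsorbing p f K) (hf : Measurable (Function.uncurry f))
    {h : X → ℝ} (hh : IsHarmonic p f h) (hc : Continuous h) {x₀ : X} (hx₀ : x₀ ∈ K)
    (hmax : ∀ x ∈ K, h x ≤ h x₀) : IsAbsorbing p f (K ∩ {x | h x = h x₀}) where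
  isClosed := hK.isClosed.inter (isClosed_eq hc continuous_const)
  nonempty := ⟨x₀, hx₀, rfl⟩
  ae_mem := by
    rintro x ⟨hxK, hx⟩
    obtain ⟨C, hC⟩ := hh.bounded
    have hfx : Measurable fun t => f t x := hf.comp measurable_prodMk_right
    have hint : Integrable (fun t => h (f t x)) p :=
      integrable_of_bounded (hh.measurable.comp hfx) fun t => hC _
    have hnn : 0 ≤ᵐ[p] fun t => h x₀ - h (f t x) := by
      filter_upwards [hK.ae_mem x hxK] with t ht
      exact sub_nonneg.2 (hmax _ ht)
    have h0 : ∫ t, (h x₀ - h (f t x)) ∂p = 0 := by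
      rw [integral_sub (integrable_const _) hint, hh.integral_eq, show h x = h x₀ from hx]
      simp
    rw [integral_eq_zero_iff_of_nonneg_ae hnn ((integrable_const _).sub hint)] at h0
    filter_upwards [hK.ae_mem x hxK, h0] with t ht ht'
    exact ⟨ht, (sub_eq_zero.1 ht').symm⟩

variable [CompactSpace X]

lemma IsAbsorbingFamily.harmonic_eq (hF : IsAbsorbingFamily p f F)
    (hmax : ∀ K' : Fin (r + 1) → Set X, ¬ IsAbsorbingFamily p f K')
    (hf : Measurable (Function.uncurry f)) {h : X → ℝ} (hh : IsHarmonic p f h)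
    (hc : Continuous h) {i : Fin r} {x y : X} (hx : x ∈ F i) (hy : y ∈ F i) : h x = h y := by
  have hi := hF.isAbsorbing i
  obtain ⟨a, ha, hamax⟩ := hi.isClosed.isCompact.exists_isMaxOn hi.nonempty hc.continuousOn
  obtain ⟨b, hb, hbmin⟩ := hi.isClosed.isCompact.exists_isMinOn hi.nonempty hc.continuousOn
  have hA := hi.argmax hf hh hc ha fun z hz => hamax hz
  have hB := hi.argmax hf hh.neg hc.neg hb fun z hz => neg_le_neg (hbmin hz)
  have hAB := hF.not_disjoint_of_subset hmax hA hB Set.inter_subset_left Set.inter_subset_left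
  obtain ⟨z, ⟨-, hz⟩, ⟨-, hz'⟩⟩ := Set.not_disjoint_iff.1 hAB
  have hab : h a = h b := (show h z = h a from hz).symm.trans (neg_injective hz')
  have h1 : h x ≤ h a := hamax hx
  have h2 : h y ≤ h a := hamax hy
  have h3 : h b ≤ h x := hbmin hx
  have h4 : h b ≤ h y := hbmin hy
  linarith

/-- The minimum of a harmonic function is attained on the union of a family of the largest
size. -/
lemma IsAbsorbingFamily.le_harmonic [Nonempty X] (hF : IsAbsorbingFamily p f F)
    (hmax : ∀ K' : Fin (r + 1) → Set X, ¬ IsAbsorbingFamily p f K')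
    (hf : Measurable (Function.uncurry f)) {h : X → ℝ} (hh : IsHarmonic p f h)
    (hc : Continuous h) {c : ℝ} (hge : ∀ i, ∀ x ∈ F i, c ≤ h x) (x : X) : c ≤ h x := by
  -- The whole space is absorbing, hence so is the set where `h` is minimal.
  have huniv : IsAbsorbing p f (Set.univ : Set X) :=
    ⟨isClosed_univ, Set.univ_nonempty, fun _ _ => ae_of_all _ fun _ => Set.mem_univ _⟩
  obtain ⟨b, -, hbmin⟩ := isCompact_univ.exists_isMinOn huniv.nonempty hc.continuousOn
  have hB := huniv.argmax hf hh.neg hc.neg (Set.mem_univ b)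
    fun z hz => neg_le_neg (hbmin hz)
  obtain ⟨i, hi⟩ := hF.exists_not_disjoint hmax hB
  obtain ⟨z, ⟨-, hz⟩, hzi⟩ := Set.not_disjoint_iff.1 hi
  have h1 : h z = h b := neg_injective hz
  have h2 : h b ≤ h x := hbmin (Set.mem_univ x)
  exact (hge i z hzi).trans (h1.le.trans h2)

end Absorbing

/-! ### The pointwise ergodic theorem -/

section Birkhoff

variable {Y : Type*}

/-- The maximum of the Birkhoff sums `S₀, …, Sₙ` of `g`, computed by the recursion
`max_{k ≤ n + 1} S_k = max 0 (g + (max_{k ≤ n} S_k) ∘ F)`. -/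
def maxBirkhoffSum (F : Y → Y) (g : Y → ℝ) : ℕ → Y → ℝ
  | 0, _ => 0
  | n + 1, z => max 0 (g z + maxBirkhoffSum F g n (F z))

lemma maxBirkhoffSum_nonneg (F : Y → Y) (g : Y → ℝ) (n : ℕ) (z : Y) :
    0 ≤ maxBirkhoffSum F g n z := by
  cases n with
  | zero => exact le_rfl
  | succ n => exact le_max_left _ _

lemma birkhoffSum_le_maxBirkhoffSum (F : Y → Y) (g : Y → ℝ) {k n : ℕ} (hkn : k ≤ n) (z : Y) :
    birkhoffSum F g k z ≤ maxBirkhoffSum F g n z := by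
  induction n generalizing k z with
  | zero => simp [Nat.le_zero.1 hkn, maxBirkhoffSum]
  | succ n ih =>
    cases k with
    | zero => simpa using maxBirkhoffSum_nonneg F g (n + 1) z
    | succ k =>
      rw [birkhoffSum_succ']
      exact le_max_of_le_right (add_le_add_right (ih (Nat.le_of_succ_le_succ hkn) (F z)) _)

lemma maxBirkhoffSum_le (F : Y → Y) {g : Y → ℝ} {C : ℝ} (hC : ∀ z, |g z| ≤ C) (n : ℕ) (z : Y) :
    maxBirkhoffSum F g n z ≤ n * C := by
  have hC0 : 0 ≤ C := (abs_nonneg _).trans (hC z)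
  induction n generalizing z with
  | zero => simp [maxBirkhoffSum]
  | succ n ih =>
    refine max_le (by positivity) ?_
    push_cast
    linarith [ih (F z), (abs_le.1 (hC z)).2]

variable [MeasurableSpace Y] {μ : Measure Y} [IsProbabilityMeasure μ] {F : Y → Y} {g : Y → ℝ}

lemma measurable_maxBirkhoffSum (hF : Measurable F) (hg : Measurable g) (n : ℕ) :
    Measurable (maxBirkhoffSum F g n) := by
  induction n with
  | zero => exact measurable_const
  | succ n ih => exact measurable_const.max (hg.add (ih.comp hF))

lemma measurable_birkhoffSum (hF : Measurable F) (hg : Measurable g) (n : ℕ) :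
    Measurable (birkhoffSum F g n) := by
  unfold birkhoffSum
  exact Finset.measurable_sum _ fun k _ => hg.comp (hF.iterate k)

/-- The set where the Birkhoff sums are unbounded above is invariant. If it had full measure, then
`max_{k ≤ n + 1} S_k - (max_{k ≤ n} S_k) ∘ F` would converge to `g` boundedly, although its
integrals are nonnegative. -/
lemma ae_bddAbove_birkhoffSum (hF : Ergodic F μ) (hg : Measurable g) {C : ℝ}
    (hC : ∀ z, |g z| ≤ C) (hneg : ∫ z, g z ∂μ < 0) :
    ∀ᵐ z ∂μ, BddAbove (Set.range fun n => birkhoffSum F g n z) := by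
  have hFm := hF.measurable
  set E : Set Y := {z | ∀ k : ℕ, ∃ n, (k : ℝ) < birkhoffSum F g n z} with hE
  have hEm : MeasurableSet E := by
    simp only [hE, Set.ofPred_forall, Set.ofPred_exists]
    exact MeasurableSet.iInter fun k => MeasurableSet.iUnion fun n =>
      measurableSet_lt measurable_const (measurable_birkhoffSum hFm hg n)
  have hEinv : F ⁻¹' E = E := by
    ext z
    simp only [hE, Set.mem_preimage, Set.mem_ofPred_eq]
    -- Thresholds are raised by `c ≥ C`, as `S_{n+1}` and `S_n ∘ F` differ by `g`.
    obtain ⟨c, hc⟩ := exists_nat_ge C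
    have hz := abs_le.1 (hC z)
    constructor
    · intro H k
      obtain ⟨n, hn⟩ := H (k + c)
      refine ⟨n + 1, ?_⟩
      rw [birkhoffSum_succ']
      push_cast at hn
      linarith
    · intro H k
      obtain ⟨n, hn⟩ := H (k + c)
      cases n with
      | zero =>
        rw [birkhoffSum_zero] at hn
        exact absurd hn (not_lt.2 (by positivity))
      | succ n =>
        refine ⟨n, ?_⟩
        rw [birkhoffSum_succ'] at hn
        push_cast at hn
        linarith
  rcases hF.toPreErgodic.ae_empty_or_univ hEm hEinv with h | h
  · filter_upwards [measure_eq_zero_iff_ae_notMem.1 (ae_eq_empty.1 h)] with z hz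
    simp only [hE, Set.mem_ofPred_eq, not_forall, not_exists, not_lt] at hz
    obtain ⟨k, hk⟩ := hz
    exact ⟨k, Set.forall_mem_range.2 hk⟩
  · exfalso
    have hMi : ∀ n, Integrable (maxBirkhoffSum F g n) μ := fun n =>
      integrable_of_bounded (measurable_maxBirkhoffSum hFm hg n) (C := n * C) fun z => by
        rw [abs_of_nonneg (maxBirkhoffSum_nonneg F g n z)]
        exact maxBirkhoffSum_le F hC n z
    have hMFi : ∀ n, Integrable (fun z => maxBirkhoffSum F g n (F z)) μ := fun n =>
      hF.toMeasurePreserving.integrable_comp_of_integrable (hMi n)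
    have hMF : ∀ n, ∫ z, maxBirkhoffSum F g n (F z) ∂μ = ∫ z, maxBirkhoffSum F g n z ∂μ := by
      intro n
      conv_rhs => rw [← hF.map_eq]
      rw [integral_map hFm.aemeasurable
        (measurable_maxBirkhoffSum hFm hg n).aestronglyMeasurable]
    have hmono : ∀ n z, maxBirkhoffSum F g n z ≤ maxBirkhoffSum F g (n + 1) z := by
      intro n
      induction n with
      | zero => exact fun z => maxBirkhoffSum_nonneg F g 1 z
      | succ n ih => exact fun z => max_le_max_left _ (add_le_add_right (ih (F z)) _)
    have hD : ∀ n, 0 ≤ ∫ z, (maxBirkhoffSum F g (n + 1) z - maxBirkhoffSum F g n (F z)) ∂μ := by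
      intro n
      rw [integral_sub (hMi _) (hMFi n), hMF, sub_nonneg]
      exact integral_mono (hMi _) (hMi _) (hmono n)
    have hlim : Tendsto (fun n => ∫ z, (maxBirkhoffSum F g (n + 1) z
        - maxBirkhoffSum F g n (F z)) ∂μ) atTop (𝓝 (∫ z, g z ∂μ)) := by
      refine tendsto_integral_of_dominated_convergence (fun _ => C)
        (fun n => ((hMi _).sub (hMFi n)).aestronglyMeasurable) (integrable_const C) ?_ ?_
      · refine fun n => ae_of_all _ fun z => ?_
        have h0 := maxBirkhoffSum_nonneg F g n (F z)
        have hz := abs_le.1 (hC z)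
        have hC0 : 0 ≤ C := (abs_nonneg _).trans (hC z)
        rw [Real.norm_eq_abs, abs_le]
        constructor
        · have : g z + maxBirkhoffSum F g n (F z) ≤ maxBirkhoffSum F g (n + 1) z :=
            le_max_right _ _
          linarith
        · have : maxBirkhoffSum F g (n + 1) z ≤ maxBirkhoffSum F g n (F z) + C :=
            max_le (by linarith) (by linarith)
          linarith
      · filter_upwards [eventuallyEq_univ.1 h] with z hz
        have hFz : F z ∈ E := by rw [← hEinv] at hz; exact hz
        -- Once the maximum at `F z` exceeds `C`, the truncation at `0` is inactive.
        obtain ⟨c, hc⟩ := exists_nat_ge C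
        obtain ⟨n, hn⟩ := hFz c
        refine tendsto_const_nhds.congr' ?_
        filter_upwards [eventually_ge_atTop n] with k hk
        have h1 := birkhoffSum_le_maxBirkhoffSum F g hk (F z)
        have hz := abs_le.1 (hC z)
        have h2 : maxBirkhoffSum F g (k + 1) z = g z + maxBirkhoffSum F g k (F z) :=
          max_eq_right (by linarith)
        rw [h2, add_sub_cancel_right]
    exact absurd (ge_of_tendsto' hlim hD) (not_le.2 hneg)

lemma ae_eventually_birkhoffAverage_le (hF : Ergodic F μ) (hg : Measurable g) {C : ℝ}
    (hC : ∀ z, |g z| ≤ C) {ε : ℝ} (hε : 0 < ε) :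
    ∀ᵐ z ∂μ, ∀ᶠ n in atTop, birkhoffAverage ℝ F g n z ≤ (∫ z, g z ∂μ) + ε := by
  set c := (∫ z, g z ∂μ) + ε / 2 with hc
  have hbd := ae_bddAbove_birkhoffSum hF (hg.sub_const c) (C := C + |c|)
    (fun z => (abs_sub _ _).trans (add_le_add_left (hC z) _)) (by
      rw [integral_sub (integrable_of_bounded hg hC) (integrable_const c)]
      simp [hc, hε])
  filter_upwards [hbd] with z hz
  obtain ⟨B, hB⟩ := hz
  have hlim : Tendsto (fun n : ℕ => B / n) atTop (𝓝 0) :=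
    tendsto_const_nhds.div_atTop tendsto_natCast_atTop_atTop
  filter_upwards [hlim.eventually_lt_const (half_pos hε), eventually_gt_atTop 0] with n hn hn0
  have hn0' : (0 : ℝ) < n := Nat.cast_pos.2 hn0
  have h1 : birkhoffSum F (fun z => g z - c) n z ≤ B := hB (Set.mem_range_self n)
  have h2 : birkhoffSum F (fun z => g z - c) n z = birkhoffSum F g n z - n * c := by
    simp [birkhoffSum, Finset.sum_sub_distrib]
  rw [h2, sub_le_iff_le_add] at h1
  rw [birkhoffAverage, smul_eq_mul, inv_mul_le_iff₀ hn0']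
  rw [div_lt_iff₀ hn0'] at hn
  have : (n : ℝ) * c = n * ((∫ z, g z ∂μ) + ε) - ε / 2 * n := by rw [hc]; ring
  linarith

/-- Birkhoff's pointwise ergodic theorem for bounded functions and ergodic maps. -/
theorem ae_tendsto_birkhoffAverage (hF : Ergodic F μ) (hg : Measurable g) {C : ℝ}
    (hC : ∀ z, |g z| ≤ C) :
    ∀ᵐ z ∂μ, Tendsto (fun n => birkhoffAverage ℝ F g n z) atTop (𝓝 (∫ z, g z ∂μ)) := by
  have hpos : ∀ k : ℕ, (0 : ℝ) < 1 / (k + 1) := fun k => Nat.one_div_pos_of_nat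
  have h1 := ae_all_iff.2 fun k => ae_eventually_birkhoffAverage_le hF hg hC (hpos k)
  have h2 := ae_all_iff.2 fun k =>
    ae_eventually_birkhoffAverage_le hF hg.neg (C := C) (by simpa using hC) (hpos k)
  filter_upwards [h1, h2] with z hz1 hz2
  rw [Metric.tendsto_atTop']
  intro ε hε
  obtain ⟨k, hk⟩ := exists_nat_one_div_lt hε
  obtain ⟨N, hN⟩ := eventually_atTop.1 ((hz1 k).and (hz2 k))
  refine ⟨N, fun n hn => ?_⟩
  obtain ⟨ha, hb⟩ := hN n hn.le
  have hneg : birkhoffAverage ℝ F (-g) n z = -birkhoffAverage ℝ F g n z := by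
    rw [birkhoffAverage_neg]; rfl
  have hint : ∫ z, (-g) z ∂μ = -∫ z, g z ∂μ := integral_neg g
  rw [hneg, hint] at hb
  rw [Real.dist_eq, abs_lt]
  constructor <;> linarith

end Birkhoff

/-! ### Stationary measures and the zero-one law -/

section Stationary

variable {T X : Type*} [MeasurableSpace T] [MeasurableSpace X]

lemma integral_average_measure {n : ℕ} {μ : ℕ → Measure X} [∀ j, IsProbabilityMeasure (μ j)]
    {φ : X → ℝ} (hφ : Measurable φ) {C : ℝ} (hC : ∀ x, |φ x| ≤ C) :
    ∫ x, φ x ∂((n : ℝ≥0)⁻¹ • ∑ j ∈ Finset.range n, μ j)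
      = (n : ℝ)⁻¹ * ∑ j ∈ Finset.range n, ∫ x, φ x ∂(μ j) := by
  rw [integral_smul_nnreal_measure,
    integral_finsetSum_measure fun j _ => integrable_of_bounded hφ hC, NNReal.smul_def]
  simp

lemma isProbabilityMeasure_average (n : ℕ) (μ : ℕ → Measure X)
    [∀ j, IsProbabilityMeasure (μ j)] :
    IsProbabilityMeasure (((n + 1 : ℕ) : ℝ≥0)⁻¹ • ∑ j ∈ Finset.range (n + 1), μ j) := by
  refine ⟨?_⟩
  have h0 : ((n + 1 : ℕ) : ℝ≥0) ≠ 0 := by positivity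
  have h1 : ((n + 1 : ℕ) : ℝ≥0∞) = (((n + 1 : ℕ) : ℝ≥0) : ℝ≥0∞) := rfl
  rw [Measure.smul_apply, ENNReal.smul_def, Measure.finsetSum_apply]
  simp only [measure_univ, Finset.sum_const, Finset.card_range, nsmul_eq_mul, mul_one]
  rw [h1, smul_eq_mul, ← ENNReal.coe_mul, inv_mul_cancel₀ h0, ENNReal.coe_one]

lemma abs_integral_le {μ : Measure X} [IsProbabilityMeasure μ] {φ : X → ℝ} {C : ℝ}
    (hC : ∀ x, |φ x| ≤ C) : |∫ x, φ x ∂μ| ≤ C := by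
  simpa using norm_integral_le_of_norm_le_const (μ := μ) (f := φ) (C := C) (ae_of_all _ hC)

variable (p : Measure T) [IsProbabilityMeasure p] {f : T → X → X}

lemma push_iterate_apply (hf : Measurable (Function.uncurry f)) (μ : Measure X)
    [IsProbabilityMeasure μ] (n : ℕ) {A : Set X} (hA : MeasurableSet A) :
    (push p f)^[n] μ A = ∫⁻ x, transitionProb p f n x A ∂μ := by
  rw [← map_iter_prod p hf, Measure.map_apply (measurable_iter hf n) hA,
    Measure.prod_apply_symm (measurable_iter hf n hA)]
  rfl

lemma absolutelyContinuous_of_push_eq (hf : Measurable (Function.uncurry f)) {μ : Measure X}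
    [IsProbabilityMeasure μ] (hμ : push p f μ = μ) {m : Measure X} {n : ℕ}
    (hn : ∀ x A, MeasurableSet A → m A = 0 → transitionProb p f n x A = 0) : μ ≪ m := by
  refine Measure.AbsolutelyContinuous.mk fun A hA hmA => ?_
  rw [← Function.iterate_fixed hμ n, push_iterate_apply p hf μ n hA]
  simp [hn _ A hA hmA]

variable {p}

/-- A weak* limit point of the averaged laws of an orbit that starts in `K` need not be stationary,
as the one-step transition may fail to be Feller, but its image under the strong Feller
`n`-step transition is. -/
lemma IsAbsorbing.exists_stationary [TopologicalSpace X] [T2Space X] [CompactSpace X]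
    [BorelSpace X] {K : Set X} (hK : IsAbsorbing p f K)
    (hf : Measurable (Function.uncurry f)) {n : ℕ} (hF : StrongFeller p f n) :
    ∃ μ : ProbabilityMeasure X, push p f μ = (μ : Measure X) ∧ (μ : Measure X) Kᶜ = 0 := by
  obtain ⟨x, hx⟩ := hK.nonempty
  have hδ : ∀ j, IsProbabilityMeasure ((push p f)^[j] (Measure.dirac x)) :=
    isProbabilityMeasure_push_iterate p hf _
  -- The averages run over `N + 1` terms, so that they are probability measures also for `N = 0`.
  let avg : ℕ → ProbabilityMeasure X := fun N =>
    ⟨((N + 1 : ℕ) : ℝ≥0)⁻¹ • ∑ j ∈ Finset.range (N + 1), (push p f)^[j] (Measure.dirac x),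
      isProbabilityMeasure_average N _⟩
  obtain ⟨ν, -, hν⟩ := isCompact_univ.ultrafilter_le_nhds ((hyperfilter ℕ).map avg) (by simp)
  have hν' : Tendsto avg (hyperfilter ℕ) (𝓝 ν) := hν
  -- Weak convergence applies to bounded measurable `φ` because the `n`-step transition makes `φ`
  -- continuous.
  have key : ∀ φ : X → ℝ, Measurable φ → (∃ C, ∀ y, |φ y| ≤ C) →
      Tendsto (fun N : ℕ => ((N + 1 : ℕ) : ℝ)⁻¹ * ∑ j ∈ Finset.range (N + 1),
        ∫ y, φ y ∂((push p f)^[j + n] (Measure.dirac x))) (hyperfilter ℕ)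
        (𝓝 (∫ y, φ y ∂((push p f)^[n] (ν : Measure X)))) := by
    rintro φ hφ ⟨C, hC⟩
    have hc := hF φ hφ ⟨C, hC⟩
    have hb : ∀ y, |∫ z, φ z ∂(law p f n y)| ≤ C := by
      intro y
      have := isProbabilityMeasure_law p hf n y
      exact abs_integral_le hC
    have h := ProbabilityMeasure.tendsto_iff_forall_integral_tendsto.1 hν'
      (BoundedContinuousFunction.mkOfCompact ⟨_, hc⟩)
    simp only [BoundedContinuousFunction.mkOfCompact_apply, ContinuousMap.coe_mk] at h
    rw [integral_push_iterate p hf _ n hφ hC]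
    refine h.congr fun N => ?_
    refine (integral_average_measure hc.measurable hb).trans ?_
    congr 1
    refine Finset.sum_congr rfl fun j _ => ?_
    rw [← integral_push_iterate p hf _ n hφ hC, ← Function.iterate_add_apply, add_comm j n]
  have hind : ∀ {A : Set X}, MeasurableSet A → Measurable (A.indicator (1 : X → ℝ)) ∧
      ∀ y, |A.indicator (1 : X → ℝ) y| ≤ 1 := by
    refine fun {A} hA => ⟨measurable_one.indicator hA, fun y => ?_⟩
    by_cases hy : y ∈ A <;> simp [Set.indicator, hy]
  have hμ := isProbabilityMeasure_push_iterate p hf (ν : Measure X) n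
  refine ⟨⟨(push p f)^[n] (ν : Measure X), hμ⟩, ?_, ?_⟩
  · have hμ' := isProbabilityMeasure_push p hf ((push p f)^[n] (ν : Measure X))
    ext A hA
    change push p f ((push p f)^[n] (ν : Measure X)) A = (push p f)^[n] (ν : Measure X) A
    obtain ⟨hφ, hC⟩ := hind hA
    set φ := A.indicator (1 : X → ℝ) with hφdef
    have hψ : Measurable fun y => ∫ t, φ (f t y) ∂p := by
      have h2 : Measurable fun z : X × T => φ (f z.2 z.1) :=
        hφ.comp (hf.comp measurable_swap)
      exact (h2.stronglyMeasurable.integral_prod_right (ν := p)).measurable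
    have hψC : ∀ y, |∫ t, φ (f t y) ∂p| ≤ 1 := fun y => abs_integral_le fun t => hC _
    have h1 := key φ hφ ⟨1, hC⟩
    have h2 := key _ hψ ⟨1, hψC⟩
    have hstep : ∀ j, ∫ y, ∫ t, φ (f t y) ∂p ∂((push p f)^[j + n] (Measure.dirac x))
        = ∫ y, φ y ∂((push p f)^[j + 1 + n] (Measure.dirac x)) := by
      intro j
      have := hδ (j + n)
      rw [add_right_comm, Function.iterate_succ_apply' (push p f), integral_push p hf _ hφ hC]
    -- By the shift `hstep` the difference of the two averages telescopes.
    have h0 : Tendsto (fun N : ℕ => ((N + 1 : ℕ) : ℝ)⁻¹ * ∑ j ∈ Finset.range (N + 1),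
        ∫ y, ∫ t, φ (f t y) ∂p ∂((push p f)^[j + n] (Measure.dirac x))
        - ((N + 1 : ℕ) : ℝ)⁻¹ * ∑ j ∈ Finset.range (N + 1),
        ∫ y, φ y ∂((push p f)^[j + n] (Measure.dirac x))) (hyperfilter ℕ) (𝓝 0) := by
      have hlim : Tendsto (fun N : ℕ => ((N + 1 : ℕ) : ℝ)⁻¹ * 2) atTop (𝓝 0) := by
        have := (tendsto_natCast_atTop_atTop (R := ℝ)).comp (tendsto_add_atTop_nat 1)
        simpa using this.inv_tendsto_atTop.mul_const 2
      refine squeeze_zero_norm (fun N => ?_) (hlim.mono_left Nat.hyperfilter_le_atTop)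
      simp only [hstep]
      have hb : ∀ j, |∫ y, φ y ∂((push p f)^[j + n] (Measure.dirac x))| ≤ 1 := fun j => by
        have := hδ (j + n)
        exact abs_integral_le hC
      rw [← mul_sub, ← Finset.sum_sub_distrib, Finset.sum_range_sub
        (fun j => ∫ y, φ y ∂((push p f)^[j + n] (Measure.dirac x))), norm_mul, norm_inv,
        Real.norm_natCast]
      gcongr
      refine (norm_sub_le _ _).trans ?_
      have := hb (N + 1)
      have := hb 0
      simp only [Real.norm_eq_abs]
      linarith
    have heq := sub_eq_zero.1 (tendsto_nhds_unique (h2.sub h1) h0)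
    rw [← integral_push p hf _ hφ hC, integral_indicator_one hA, integral_indicator_one hA] at heq
    exact (measureReal_eq_measureReal_iff (measure_ne_top _ _) (measure_ne_top _ _)).1 heq
  · have hKm := hK.isClosed.measurableSet.compl
    obtain ⟨hφ, hC⟩ := hind hKm
    have h1 := key _ hφ ⟨1, hC⟩
    have hx0 : Measure.dirac x Kᶜ = 0 := by simp [Measure.dirac_apply' x hKm, hx]
    have hz : ∀ j, ∫ y, Kᶜ.indicator (1 : X → ℝ) y ∂((push p f)^[j] (Measure.dirac x)) = 0 := by
      intro j
      rw [integral_indicator_one hKm, measureReal_def, hK.push_iterate_compl hf hx0 j,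
        ENNReal.toReal_zero]
    simp only [hz, Finset.sum_const_zero, mul_zero] at h1
    have heq := tendsto_nhds_unique h1 tendsto_const_nhds
    rw [integral_indicator_one hKm] at heq
    exact (measureReal_eq_zero_iff (μ := (push p f)^[n] (ν : Measure X))
      (measure_ne_top _ _)).1 heq

end Stationary

section ZeroOne

variable {T X : Type*} [MeasurableSpace T]

/-- The probability that the noise, together with the starting point `x`, lands in `B`. -/
noncomputable def fiberProb (p : Measure T) [IsProbabilityMeasure p] (B : Set ((ℕ → T) × X))
    (x : X) : ℝ :=
  (noiseMeasure p).real {ω | (ω, x) ∈ B}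

variable {p : Measure T} [IsProbabilityMeasure p] {f : T → X → X} {B : Set ((ℕ → T) × X)}

lemma abs_fiberProb_le_one (x : X) : |fiberProb p B x| ≤ 1 := by
  rw [fiberProb, abs_of_nonneg measureReal_nonneg]
  exact measureReal_le_one

variable [MeasurableSpace X]

lemma measurable_fiberProb (hB : MeasurableSet B) : Measurable (fiberProb p B) :=
  (measurable_measure_prodMk_right hB).ennreal_toReal

lemma integral_fiberProb (hB : MeasurableSet B) (μ : Measure X) [IsProbabilityMeasure μ] :
    ∫ x, fiberProb p B x ∂μ = ((noiseMeasure p).prod μ).real B := by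
  rw [measureReal_def, Measure.prod_apply_symm hB]
  exact integral_toReal (measurable_measure_prodMk_right hB).aemeasurable
    (ae_of_all _ fun x => measure_lt_top _ _)

/-- Fiber probabilities of sets invariant under the skew product are harmonic. -/
lemma isHarmonic_fiberProb (hf : Measurable (Function.uncurry f)) (hB : MeasurableSet B)
    (hinv : skewProduct f ⁻¹' B = B) : IsHarmonic p f (fiberProb p B) where
  measurable := measurable_fiberProb hB
  bounded := ⟨1, abs_fiberProb_le_one⟩
  integral_eq x := by
    have := isProbabilityMeasure_push p hf (Measure.dirac x)
    have hm : Measurable fun y => ∫ t, fiberProb p B (f t y) ∂p := by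
      have h2 : Measurable fun z : X × T => fiberProb p B (f z.2 z.1) :=
        (measurable_fiberProb hB).comp (hf.comp measurable_swap)
      exact (h2.stronglyMeasurable.integral_prod_right (ν := p)).measurable
    have h1 := (measurePreserving_skewProduct_push p hf (Measure.dirac x)).measure_preimage
      hB.nullMeasurableSet
    rw [hinv] at h1
    have h2 := integral_push p hf (Measure.dirac x) (measurable_fiberProb (p := p) hB)
      abs_fiberProb_le_one
    rw [integral_fiberProb hB, integral_dirac' _ _ hm.stronglyMeasurable, measureReal_def, ← h1,
      ← measureReal_def, ← integral_fiberProb hB,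
      integral_dirac' _ _ (measurable_fiberProb hB).stronglyMeasurable] at h2
    exact h2.symm

/-- If an invariant set has the same fiber probability `c` at all points of an absorbing set, then
its fibers there are independent of every box: after `n` steps the orbit is again in the
absorbing set, where the conditional probability is `c`. -/
lemma IsAbsorbing.noiseMeasure_inter_box [TopologicalSpace X] {K : Set X}
    (hK : IsAbsorbing p f K) (hB : MeasurableSet B)
    (hinv : skewProduct f ⁻¹' B = B) {c : ℝ≥0∞}
    (hc : ∀ x ∈ K, noiseMeasure p {ω | (ω, x) ∈ B} = c) (n : ℕ) :
    ∀ t : ℕ → Set T, (∀ i, MeasurableSet (t i)) → ∀ x ∈ K,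
      noiseMeasure p ({ω | (ω, x) ∈ B} ∩ {ω | ∀ i < n, ω i ∈ t i})
        = c * ∏ i ∈ Finset.range n, p (t i) := by
  induction n with
  | zero => intro t _ x hx; simpa using hc x hx
  | succ n ih =>
    intro t ht x hx
    have hBx : MeasurableSet {ω : ℕ → T | (ω, x) ∈ B} := measurable_prodMk_right hB
    have hS := hBx.inter (measurableSet_box ht (n + 1))
    rw [← (measurePreserving_consNoise p).measure_preimage hS.nullMeasurableSet,
      Measure.prod_apply (measurable_consNoise hS), Finset.prod_range_succ', mul_comm (∏ i ∈ _, _),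
      mul_left_comm, mul_comm (p (t 0)), ← lintegral_indicator_const (ht 0)]
    refine lintegral_congr_ae ?_
    filter_upwards [hK.ae_mem x hx] with s hs
    have hmem : ∀ ω, (consNoise (s, ω), x) ∈ B ↔ (ω, f s x) ∈ B := by
      intro ω
      conv_lhs => rw [← hinv]
      rfl
    have hbox : ∀ ω, (∀ i < n + 1, consNoise (s, ω) i ∈ t i) ↔
        s ∈ t 0 ∧ ∀ i < n, ω i ∈ t (i + 1) := by
      intro ω
      constructor
      · exact fun H => ⟨H 0 n.succ_pos, fun i hi => H (i + 1) (Nat.succ_lt_succ hi)⟩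
      · rintro ⟨h0, H⟩ i hi
        cases i with
        | zero => exact h0
        | succ i => exact H i (Nat.lt_of_succ_lt_succ hi)
    have hset : Prod.mk s ⁻¹' (consNoise ⁻¹'
        ({ω : ℕ → T | (ω, x) ∈ B} ∩ {ω | ∀ i < n + 1, ω i ∈ t i}))
        = {ω | (ω, f s x) ∈ B ∧ s ∈ t 0 ∧ ∀ i < n, ω i ∈ t (i + 1)} := by
      ext ω
      exact and_congr (hmem ω) (hbox ω)
    rw [hset]
    by_cases hs0 : s ∈ t 0
    · rw [Set.indicator_of_mem hs0, ← ih (fun i => t (i + 1)) (fun i => ht (i + 1)) _ hs]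
      simp only [hs0, true_and]
      rfl
    · simp [hs0]

/-- A zero-one law: fibers of invariant sets with constant probability on an absorbing set are
independent of themselves. -/
lemma IsAbsorbing.fiber_zero_or_one [TopologicalSpace X] {K : Set X}
    (hK : IsAbsorbing p f K) (hB : MeasurableSet B)
    (hinv : skewProduct f ⁻¹' B = B) {c : ℝ≥0∞}
    (hc : ∀ x ∈ K, noiseMeasure p {ω | (ω, x) ∈ B} = c) : c = 0 ∨ c = 1 := by
  obtain ⟨x, hx⟩ := hK.nonempty
  have hBx : MeasurableSet {ω : ℕ → T | (ω, x) ∈ B} := measurable_prodMk_right hB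
  refine or_iff_not_imp_left.2 fun hc0 => ?_
  have hctop : c ≠ ∞ := by rw [← hc x hx]; exact measure_ne_top _ _
  -- The noise conditioned on the fiber has the Bernoulli mass on every box, so it is the
  -- unconditioned noise, and the complement of the fiber is null.
  have hν : c⁻¹ • (noiseMeasure p).restrict {ω | (ω, x) ∈ B} = noiseMeasure p := by
    refine eq_noiseMeasure_of_box p fun t ht n => ?_
    rw [Measure.smul_apply, Measure.restrict_apply (measurableSet_box ht n), Set.inter_comm,
      hK.noiseMeasure_inter_box hB hinv hc n t ht x hx, smul_eq_mul, ← mul_assoc,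
      ENNReal.inv_mul_cancel hc0 hctop, one_mul]
  have h0 : noiseMeasure p {ω | (ω, x) ∈ B}ᶜ = 0 := by
    rw [← hν, Measure.smul_apply, Measure.restrict_apply hBx.compl, Set.compl_inter_self,
      measure_empty, smul_zero]
  rw [← hc x hx]
  exact (prob_compl_eq_zero_iff hBx).1 h0

lemma IsAbsorbing.isErgodic [TopologicalSpace X] {K : Set X}
    (hK : IsAbsorbing p f K) (hf : Measurable (Function.uncurry f))
    (hconst : ∀ h, IsHarmonic p f h → ∀ x ∈ K, ∀ y ∈ K, h x = h y)
    {μ : Measure X} [IsProbabilityMeasure μ] (hμ : push p f μ = μ) (hμK : μ Kᶜ = 0) :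
    IsErgodic p f μ := by
  have hpres := measurePreserving_skewProduct_push p hf μ
  rw [hμ] at hpres
  refine ⟨hpres, ⟨fun B hB hinv => ?_⟩⟩
  obtain ⟨x₀, hx₀⟩ := hK.nonempty
  have hc : ∀ x ∈ K, noiseMeasure p {ω | (ω, x) ∈ B} = noiseMeasure p {ω | (ω, x₀) ∈ B} :=
    fun x hx => (measureReal_eq_measureReal_iff (measure_ne_top _ _) (measure_ne_top _ _)).1
      (hconst _ (isHarmonic_fiberProb hf hB hinv) x hx x₀ hx₀)
  have hKae : ∀ᵐ x ∂μ, x ∈ K := hμK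
  have hprod : (noiseMeasure p).prod μ B = noiseMeasure p {ω | (ω, x₀) ∈ B} := by
    rw [Measure.prod_apply_symm hB]
    calc ∫⁻ x, noiseMeasure p ((fun ω => (ω, x)) ⁻¹' B) ∂μ
        = ∫⁻ _, noiseMeasure p {ω | (ω, x₀) ∈ B} ∂μ :=
          lintegral_congr_ae (hKae.mono fun x hx => hc x hx)
      _ = _ := by simp
  rw [eventuallyConst_set']
  rcases hK.fiber_zero_or_one hB hinv hc with h | h
  · left
    rw [h] at hprod
    exact ae_eq_empty.2 hprod
  · right
    rw [h] at hprod
    exact eventuallyEq_univ.2 ((prob_compl_eq_zero_iff hB).2 hprod)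

end ZeroOne

/-! ### Statistical basins -/

section Basin

variable {T X : Type*} [MeasurableSpace X] {f : T → X → X}

lemma measure_densitySupport_inter_compl {m μ : Measure X} {K : Set X}
    (hμK : μ Kᶜ = 0) : m (densitySupport m μ ∩ Kᶜ) = 0 := by
  have h0 : ∫⁻ x in Kᶜ, μ.rnDeriv m x ∂m = 0 :=
    le_antisymm ((Measure.setLIntegral_rnDeriv_le _).trans hμK.le) zero_le
  rw [lintegral_eq_zero_iff (Measure.measurable_rnDeriv μ m)] at h0
  have hS : MeasurableSet (densitySupport m μ) :=
    measurableSet_support (Measure.measurable_rnDeriv μ m)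
  rw [← Measure.restrict_apply hS]
  exact h0

variable [TopologicalSpace X] [PolishSpace X] [CompactSpace X]

/-- The pairs `(ω, x)` along which the time averages of a dense sequence of continuous functions
converge to their `μ`-averages. -/
def basinPairs (f : T → X → X) (μ : Measure X) : Set ((ℕ → T) × X) :=
  {z | ∀ k, Tendsto (fun n => birkhoffAverage ℝ (skewProduct f)
    (fun z => TopologicalSpace.denseSeq C(X, ℝ) k z.2) n z) atTop
    (𝓝 (∫ y, TopologicalSpace.denseSeq C(X, ℝ) k y ∂μ))}

lemma preimage_basinPairs (μ : Measure X) :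
    skewProduct f ⁻¹' basinPairs f μ = basinPairs f μ := by
  ext z
  refine forall_congr' fun k => ?_
  set g := TopologicalSpace.denseSeq C(X, ℝ) k
  have hb : Bornology.IsBounded (Set.range fun z : (ℕ → T) × X => g z.2) :=
    (isCompact_range g.continuous).isBounded.subset (by rintro _ ⟨z, rfl⟩; exact ⟨z.2, rfl⟩)
  have h := tendsto_birkhoffAverage_apply_sub_birkhoffAverage' ℝ hb (skewProduct f) z
  constructor
  · intro H
    simpa using H.sub h
  · intro H
    simpa using H.add h

variable [BorelSpace X]

lemma integral_empiricalMeasure (f : T → X → X) {φ : X → ℝ} (hφ : Continuous φ)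
    (z : (ℕ → T) × X) (n : ℕ) :
    ∫ y, φ y ∂(empiricalMeasure f z.1 z.2 n : Measure X)
      = birkhoffAverage ℝ (skewProduct f) (fun z => φ z.2) n z := by
  obtain ⟨C, hC⟩ := isCompact_univ.exists_bound_of_continuousOn hφ.continuousOn
  have h : (empiricalMeasure f z.1 z.2 n : Measure X)
      = (n : ℝ≥0)⁻¹ • ∑ j ∈ Finset.range n, Measure.dirac (iter f z.1 j z.2) := by
    rw [empiricalMeasure, FiniteMeasure.toMeasure_smul, FiniteMeasure.toMeasure_sum]
    rfl
  rw [h, integral_average_measure hφ.measurable (C := C) fun x => hC x (Set.mem_univ x)]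
  simp only [integral_dirac, birkhoffAverage, birkhoffSum, skewProduct_iterate_snd, smul_eq_mul]

lemma mem_basin_of_mem_basinPairs {μ : ProbabilityMeasure X} {z : (ℕ → T) × X}
    (hz : z ∈ basinPairs f (μ : Measure X)) : z.2 ∈ basin f z.1 μ := by
  refine FiniteMeasure.tendsto_iff_forall_integral_tendsto.2 fun φ => ?_
  simp only [integral_empiricalMeasure f φ.continuous]
  rw [Metric.tendsto_atTop]
  intro ε hε
  obtain ⟨k, hk⟩ := (TopologicalSpace.denseRange_denseSeq C(X, ℝ)).exists_dist_lt
    φ.toContinuousMap (by positivity : 0 < ε / 3)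
  have hzk := hz k
  set g := TopologicalSpace.denseSeq C(X, ℝ) k
  have hφg : ∀ y, |φ y - g y| ≤ ε / 3 := fun y =>
    ((ContinuousMap.dist_apply_le_dist (f := φ.toContinuousMap) (g := g) y).trans_lt hk).le
  have hbd : ∀ n, |birkhoffAverage ℝ (skewProduct f) (fun z => φ z.2) n z
      - birkhoffAverage ℝ (skewProduct f) (fun z => g z.2) n z| ≤ ε / 3 := by
    intro n
    rw [birkhoffAverage, birkhoffAverage, ← smul_sub, birkhoffSum, birkhoffSum,
      ← Finset.sum_sub_distrib, smul_eq_mul, abs_mul, abs_inv, Nat.abs_cast]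
    have h1 : |∑ j ∈ Finset.range n, (φ ((skewProduct f)^[j] z).2 - g ((skewProduct f)^[j] z).2)|
        ≤ n * (ε / 3) := by
      refine (Finset.abs_sum_le_sum_abs _ _).trans ?_
      refine (Finset.sum_le_sum fun j _ => hφg _).trans ?_
      simp
    exact inv_mul_le_of_le_mul₀ (by positivity) (by positivity) h1
  have hint : |(∫ y, φ y ∂(μ : Measure X)) - ∫ y, g y ∂(μ : Measure X)| ≤ ε / 3 := by
    rw [← integral_sub (integrable_of_bounded φ.continuous.measurable φ.norm_coe_le_norm)
      (integrable_of_bounded g.continuous.measurable g.norm_coe_le_norm)]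
    exact abs_integral_le hφg
  obtain ⟨N, hN⟩ := Metric.tendsto_atTop.1 hzk (ε / 3) (by positivity)
  refine ⟨N, fun n hn => ?_⟩
  have h1 := abs_le.1 (hbd n)
  have h2 := abs_le.1 hint
  have h3 := hN n hn
  rw [Real.dist_eq, abs_lt] at h3
  rw [Real.dist_eq, abs_lt]
  rw [ProbabilityMeasure.toMeasure_comp_toFiniteMeasure_eq_toMeasure]
  constructor <;> linarith [h1.1, h1.2, h2.1, h2.2, h3.1, h3.2]

variable [MeasurableSpace T]

lemma measurableSet_basinPairs (hf : Measurable (Function.uncurry f)) (μ : Measure X) :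
    MeasurableSet (basinPairs f μ) := by
  simp only [basinPairs, Set.ofPred_forall]
  exact MeasurableSet.iInter fun k => measurableSet_tendsto _ fun n =>
    (measurable_birkhoffSum (measurable_skewProduct hf)
      ((TopologicalSpace.denseSeq C(X, ℝ) k).continuous.measurable.comp measurable_snd) n).const_smul (n : ℝ)⁻¹

lemma ae_mem_basinPairs {p : Measure T} [IsProbabilityMeasure p] {μ : Measure X}
    [IsProbabilityMeasure μ] (hμ : IsErgodic p f μ) :
    ∀ᵐ z ∂((noiseMeasure p).prod μ), z ∈ basinPairs f μ := by
  refine ae_all_iff.2 fun k => ?_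
  set g := TopologicalSpace.denseSeq C(X, ℝ) k
  have h := ae_tendsto_birkhoffAverage hμ (g.continuous.measurable.comp measurable_snd) (C := ‖g‖)
    fun z => g.norm_coe_le_norm z.2
  have hint : ∫ z, g z.2 ∂((noiseMeasure p).prod μ) = ∫ y, g y ∂μ := by
    rw [integral_fun_snd (f := fun y => g y)]
    simp
  rw [← hint]
  exact h

end Basin

end RandomMap

theorem theoremA {X T : Type*}
    [TopologicalSpace X] [PolishSpace X] [CompactSpace X] [MeasurableSpace X] [BorelSpace X]
    (m : Measure X) [IsProbabilityMeasure m]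
    [MeasurableSpace T] (p : Measure T) [IsProbabilityMeasure p]
    (f : T → X → X) (hf : Measurable (Function.uncurry f))
    (n₀ : ℕ) (hn₀ : 1 ≤ n₀)
    (ρ : X → (X →₁[m] ℝ)) (hρ : Continuous ρ)
    (hP : ∀ (x : X) (A : Set X), MeasurableSet A →
      (RandomMap.transitionProb p f n₀ x A).toReal = ∫ y in A, ρ x y ∂m) :
    RandomMap.FPM m p f := by
  open RandomMap in
  have := nonempty_of_isProbabilityMeasure m
  have hF : StrongFeller p f n₀ := strongFeller_of_density hf hρ hP
  obtain ⟨r, K, hK, hmax⟩ := exists_maximal_absorbingFamily hf hρ hP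
  have hconst : ∀ i h, IsHarmonic p f h → ∀ x ∈ K i, ∀ y ∈ K i, h x = h y :=
    fun i h hh x hx y hy => hK.harmonic_eq hmax hf hh (hh.continuous p hf hF) hx hy
  choose μ hμ hμK using fun i => (hK.isAbsorbing i).exists_stationary hf hF
  have herg : ∀ i, IsErgodic p f (μ i : Measure X) := fun i =>
    (hK.isAbsorbing i).isErgodic hf (hconst i) (hμ i) (hμK i)
  refine ⟨r, μ, fun i => ⟨isStationary_of_push_eq p hf (hμ i), herg i⟩, fun i => ?_,
    fun i j hij => ?_, ?_⟩
  · refine absolutelyContinuous_of_push_eq p hf (hμ i) (n := n₀) fun x A hA hmA => ?_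
    have h := hP x A hA
    rw [setIntegral_measure_zero _ hmA, ENNReal.toReal_eq_zero_iff] at h
    exact h.resolve_right (measure_ne_top _ _)
  · refine measure_mono_null (t := (densitySupport m (μ i : Measure X) ∩ (K i)ᶜ) ∪
      (densitySupport m (μ j : Measure X) ∩ (K j)ᶜ)) ?_ (measure_union_null
        (measure_densitySupport_inter_compl (hμK i)) (measure_densitySupport_inter_compl (hμK j)))
    rintro x ⟨hi, hj⟩
    by_cases hx : x ∈ K i
    · exact Or.inr ⟨hj, Set.disjoint_left.1 (hK.disjoint hij) hx⟩
    · exact Or.inl ⟨hi, hx⟩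
  · set G : Set ((ℕ → T) × X) := ⋃ i, basinPairs f (μ i : Measure X) with hG
    have hGm : MeasurableSet G := MeasurableSet.iUnion fun i => measurableSet_basinPairs hf _
    have hGinv : skewProduct f ⁻¹' G = G := by
      simp only [hG, Set.preimage_iUnion, preimage_basinPairs]
    have hh : IsHarmonic p f (fiberProb p G) := isHarmonic_fiberProb hf hGm hGinv
    have hone : ∀ i, ∀ x ∈ K i, 1 ≤ fiberProb p G x := by
      intro i x hx
      have hKae : ∀ᵐ y ∂(μ i : Measure X), y ∈ K i := hμK i
      have h1 : ((noiseMeasure p).prod (μ i : Measure X)).real G = 1 := by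
        rw [measureReal_def, (prob_compl_eq_zero_iff hGm).1, ENNReal.toReal_one]
        have hae : ∀ᵐ z ∂((noiseMeasure p).prod (μ i : Measure X)), z ∈ G :=
          (ae_mem_basinPairs (herg i)).mono fun z hz => Set.mem_iUnion.2 ⟨i, hz⟩
        exact hae
      rw [← integral_fiberProb hGm, integral_congr_ae (g := fun _ => fiberProb p G x)
        (hKae.mono fun y hy => hconst i _ hh y hy x hx)] at h1
      simpa using h1.ge
    have hall := hK.le_harmonic hmax hf hh (hh.continuous p hf hF) hone
    have hGae : ∀ᵐ z ∂((noiseMeasure p).prod m), z ∈ G := by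
      refine (prob_compl_eq_zero_iff hGm).2 (le_antisymm prob_le_one ?_)
      rw [← ENNReal.toReal_le_toReal ENNReal.one_ne_top (measure_ne_top _ _), ← measureReal_def,
        ← integral_fiberProb hGm, ENNReal.toReal_one]
      simpa using integral_mono (μ := m) (integrable_const 1)
        (integrable_of_bounded (measurable_fiberProb hGm) abs_fiberProb_le_one) hall
    filter_upwards [Measure.ae_ae_of_ae_prod hGae] with ω hω
    have hbasin : ∀ᵐ x ∂m, x ∈ ⋃ i, basin f ω (μ i) := by
      filter_upwards [hω] with x hx
      obtain ⟨i, hi⟩ := Set.mem_iUnion.1 hx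
      exact Set.mem_iUnion.2 ⟨i, mem_basin_of_mem_basinPairs (z := (ω, x)) hi⟩
    exact hbasin
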